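/- Let $\mathcal X,\mathcal Y$ be finite-dimensional Euclidean spaces. A gauge is a convex, positively homogeneous function $\kappa$ with values in $[0,+\infty]$ and $\kappa(0)=0$; it is closed if it is lower semicontinuous. Its polar is $\kappa^\circ(y)=\inf\{\mu>0 : \langle x,y\rangle\le\mu\kappa(x)\ \forall x\}$. For functions $f,g$ put $(f\diamond g)(x)=\inf_z\max\{f(z),g(x-z)\}$, and for $t>0$ put $\operatorname{prox}_{tf}(x)=\operatorname{argmin}_z\{f(z)+\tfrac1{2t}\|x-z\|^2\}$, where $\|\cdot\|$ is the Euclidean norm. Theorem (Primal and dual problems under polar convolution). Let $\kappa$ be a closed gauge on $\mathcal X$ and $\rho$ a closed gauge on $\mathcal Y$ with $\kappa^{-1}(0)=\{0\}$ and $\rho^{-1}(0)=\{0\}$. Let $A:\mathcal X\to\mathcal Y$ be linear with adjoint $A^*$, $b\in\mathcal Y$, $\sigma\in[0,\rho(b))$ a real number, and $\alpha>0$. Set $\mathcal C=\{u:\rho(b-u)\le\sigma\}$ and assume $\operatorname{ri}\operatorname{dom}\kappa\cap A^{-1}\operatorname{ri}\mathcal C\ne\emptyset$, where $\operatorname{dom}\kappa=\{x:\kappa(x)<\infty\}$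 and $\operatorname{ri}$ is the relative interior. Consider $$\text{(P)}\quad \min_{x\in\mathcal X}\ \kappa(x)+\alpha\|x\|\quad\text{subject to}\quad \rho(b-Ax)\le\sigma,$$ $$\text{(D)}\quad \min_{y\in\mathcal Y}\ \bigl(\kappa^\circ\diamond\tfrac1\alpha\|\cdot\|\bigr)(A^*y)\quad\text{subject to}\quad \langle b,y\rangle-\sigma\rho^\circ(y)\ge1.$$ Then: (i) The optimal values of (P) and (D) are finite, positive and attained, and they are reciprocals of each other. (ii) The objective of (D) is finite and continuously differentiable, with a locally Lipschitz gradient, on some open set containing the feasible set of (D). (iii) Let $\bar y$ be any optimal solution of (D) and let $\bar r$ be the optimal value of (D). Then $\operatorname{prox}_{\bar r\kappa}(A^*\bar y)$ consists of a single point $p$, one has $\kappa(p)<\infty$ and $p\ne0$, and $$\widehat x=\frac{1/\bar r}{\kappa(p)+\alpha\|p\|}\,p$$ is an optimal solution of (P). -/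

import Mathlib

open scoped ENNReal InnerProductSpace

noncomputable section

/-- A gauge: a nonnegative extended-real-valued convex function that is positively homogeneous
and vanishes at the origin. -/
structure IsGauge {E : Type*} [AddCommGroup E] [Module ℝ E] (κ : E → ℝ≥0∞) : Prop where
  map_zero : κ 0 = 0
  map_smul : ∀ (t : ℝ) (x : E), 0 < t → κ (t • x) = ENNReal.ofReal t * κ x
  convex : ∀ (x y : E) (a b : ℝ), 0 ≤ a → 0 ≤ b → a + b = 1 →
    κ (a • x + b • y) ≤ ENNReal.ofReal a * κ x + ENNReal.ofReal b * κ y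

/-- The effective domain of an extended-real-valued function. -/
def effDom {E : Type*} (f : E → ℝ≥0∞) : Set E := {x | f x < ⊤}

/-- The polar `κ°(y) = inf {μ > 0 | ⟪x, y⟫ ≤ μ κ(x) for all x}`. Since the right-hand side is
nonnegative, replacing `⟪x, y⟫` by its positive part does not change the condition. -/
def polarGauge {E : Type*} [NormedAddCommGroup E] [InnerProductSpace ℝ E]
    (κ : E → ℝ≥0∞) (y : E) : ℝ≥0∞ :=
  ⨅ (μ : ℝ) (_ : 0 < μ ∧ ∀ x : E, ENNReal.ofReal ⟪x, y⟫_ℝ ≤ ENNReal.ofReal μ * κ x),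
    ENNReal.ofReal μ

/-- Infimal max convolution `(f ⋄ g)(x) = inf_z max (f z) (g (x - z))`. -/
def maxConv {E : Type*} [AddCommGroup E] (f g : E → ℝ≥0∞) (x : E) : ℝ≥0∞ :=
  ⨅ z : E, max (f z) (g (x - z))

/-- The polar envelope `κ ⋄ (1/α)‖·‖`. -/
def polarEnvelope {E : Type*} [NormedAddCommGroup E] (κ : E → ℝ≥0∞) (α : ℝ) : E → ℝ≥0∞ :=
  maxConv κ (fun z => ENNReal.ofReal ((1 / α) * ‖z‖))

/-- The (set-valued) proximal map `prox_{tf}(x) = argmin_z {f z + (1/(2t)) ‖x - z‖²}`. -/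
def proxSet {E : Type*} [NormedAddCommGroup E] (t : ℝ) (f : E → ℝ≥0∞) (x : E) : Set E :=
  {z | IsMinOn (fun w => f w + ENNReal.ofReal (1 / (2 * t) * ‖x - w‖ ^ 2)) Set.univ z}

/-- The optimal value of `minimize f over S`. -/
def optValue {E : Type*} (S : Set E) (f : E → ℝ≥0∞) : ℝ≥0∞ := ⨅ x ∈ S, f x

/-- `x` is an optimal solution of `minimize f over S`. -/
def IsOptSol {E : Type*} (S : Set E) (f : E → ℝ≥0∞) (x : E) : Prop := x ∈ S ∧ IsMinOn f S x

/-- The set `C = {u | ρ(b - u) ≤ σ}`. -/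
def constraintSet {Y : Type*} [AddCommGroup Y] (ρ : Y → ℝ≥0∞) (b : Y) (σ : ℝ) : Set Y :=
  {u | ρ (b - u) ≤ ENNReal.ofReal σ}

/-- The feasible set `{x | ρ(b - A x) ≤ σ}` of the primal problem. -/
def primalFeas {X Y : Type*} [AddCommGroup X] [Module ℝ X] [AddCommGroup Y] [Module ℝ Y]
    (ρ : Y → ℝ≥0∞) (A : X →ₗ[ℝ] Y) (b : Y) (σ : ℝ) : Set X :=
  {x | ρ (b - A x) ≤ ENNReal.ofReal σ}

/-- The objective `κ(x) + α‖x‖` of the regularized primal problem. -/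
def primalObj {X : Type*} [NormedAddCommGroup X] (κ : X → ℝ≥0∞) (α : ℝ) (x : X) : ℝ≥0∞ :=
  κ x + ENNReal.ofReal (α * ‖x‖)

/-- The feasible set `{y | ⟪b, y⟫ - σ ρ°(y) ≥ 1}` of the dual problem. -/
def dualFeas {Y : Type*} [NormedAddCommGroup Y] [InnerProductSpace ℝ Y]
    (ρ : Y → ℝ≥0∞) (b : Y) (σ : ℝ) : Set Y :=
  {y | (1 : EReal) ≤ ((⟪b, y⟫_ℝ : ℝ) : EReal) - (σ : EReal) * (polarGauge ρ y : EReal)}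

/-- The objective `(κ° ⋄ (1/α)‖·‖)(A* y)` of the dual problem. -/
def dualObj {X Y : Type*} [NormedAddCommGroup X] [InnerProductSpace ℝ X] [FiniteDimensional ℝ X]
    [NormedAddCommGroup Y] [InnerProductSpace ℝ Y] [FiniteDimensional ℝ Y]
    (κ : X → ℝ≥0∞) (α : ℝ) (A : X →ₗ[ℝ] Y) (y : Y) : ℝ≥0∞ :=
  polarEnvelope (polarGauge κ) α (LinearMap.adjoint A y)

/-- `F` is finite and continuously differentiable on a neighbourhood of `S`, with a locally
Lipschitz gradient `G` there. -/
def HasLocallyLipschitzGradientOn {Y : Type*} [NormedAddCommGroup Y] [InnerProductSpace ℝ Y]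
    (F : Y → ℝ≥0∞) (S : Set Y) : Prop :=
  ∃ U : Set Y, IsOpen U ∧ S ⊆ U ∧ (∀ y ∈ U, F y ≠ ⊤) ∧
    ∃ G : Y → Y, (∀ y ∈ U, HasFDerivAt (fun z => (F z).toReal) (innerSL ℝ (G y)) y) ∧
      LocallyLipschitzOn U G

end

/-!
Write `φ = κ + α‖·‖` for the primal objective and `φ°` for its polar. The dual objective at `y` is
`φ°(A* y)` (`polarEnvelope_polarGauge`), and the dual constraint says that `⟪·, y⟫ ≥ 1` on
`C = {u | ρ (b - u) ≤ σ}` (`mem_dualFeas_iff`). So the polar inequality `⟪x, z⟫ ≤ φ(x) φ°(z)` gives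
`1 ≤ φ(x) φ°(A* y)` for feasible `x` and `y`, which is weak duality.

The primal problem has a solution by compactness, and its value `v` is positive because `0` is
infeasible. The sets `A {φ < v}` and `C` are disjoint, and properly separating them yields a
vector `y` with `⟪·, y⟫ ≥ 1` on `C` and `φ°(A* y) ≤ 1 / v` (`exists_dual_multiplier`). The
constraint qualification excludes the degenerate separating functionals, since a functional with
constant sign on a set that vanishes at a relative interior point vanishes on the whole set.

Everything else rests on the proximal map. The point `p = prox_{tκ}(z)` is characterized by
`⟪x, z - p⟫ ≤ t κ(x)` for all `x`, with equality at `p` (`IsProxPoint`), and it depends Lipschitz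
continuously on `z` and `t` by monotonicity. For `t = φ°(z) > 0` one has `‖p‖ = α t`
(`IsProxPoint.norm_eq`) and `⟪p, z⟫ = t φ(p)`. By the polar inequality `p / φ(p)` is then a
subgradient of `φ°` at `z`. A locally Lipschitz selection of subgradients is a gradient
(`hasFDerivAt_of_continuousOn_subgradient`), which gives the smoothness of the dual objective. If
`y` solves the dual problem, `z = A* y`, `r = φ°(z) = 1 / v`, and `x` solves the primal problem, then
`1 ≤ ⟪x, z⟫ ≤ r κ(x) + ‖p‖ ‖x‖ = r φ(x) = 1` for `p = prox_{rκ}(z)`. The equality in the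
Cauchy–Schwarz inequality makes `x` the multiple of `p` that the recovery formula describes
(`IsProxPoint.smul_eq`).
-/

/-! ### Existence of minimizers and separation in finite dimension -/

theorem LowerSemicontinuous.exists_isMinOn_of_norm_le {E : Type*} [NormedAddCommGroup E]
    [NormedSpace ℝ E] [FiniteDimensional ℝ E] {f : E → ℝ≥0∞} (hf : LowerSemicontinuous f)
    {S : Set E} (hS : IsClosed S) {x₀ : E} (hx₀ : x₀ ∈ S) {R : ℝ}
    (hR : ∀ x ∈ S, f x ≤ f x₀ → ‖x‖ ≤ R) : ∃ x ∈ S, IsMinOn f S x := by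
  have : ProperSpace E := FiniteDimensional.proper ℝ E
  obtain ⟨x, hx, hmin⟩ := LowerSemicontinuousOn.exists_isMinOn (f := f)
    (s := S ∩ Metric.closedBall 0 R) ⟨x₀, hx₀, by simpa using hR x₀ hx₀ le_rfl⟩
    ((isCompact_closedBall 0 R).inter_left hS) (hf.lowerSemicontinuousOn _)
  refine ⟨x, hx.1, fun w hw => ?_⟩
  have h0 : f x ≤ f x₀ := hmin ⟨hx₀, by simpa using hR x₀ hx₀ le_rfl⟩
  rcases le_total (f w) (f x₀) with h | h
  · exact hmin ⟨hw, by simpa using hR w hw h⟩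
  · exact h0.trans h

theorem exists_sub_smul_mem_of_mem_intrinsicInterior {E : Type*} [NormedAddCommGroup E]
    [NormedSpace ℝ E] {s : Set E} {x y : E} (hx : x ∈ intrinsicInterior ℝ s) (hy : y ∈ s) :
    ∃ ε : ℝ, 0 < ε ∧ x - ε • (y - x) ∈ s := by
  obtain ⟨x', hx', rfl⟩ := hx
  have hmem : ∀ ε : ℝ, (x' : E) - ε • (y - x') ∈ affineSpan ℝ s := fun ε => by
    have := AffineMap.lineMap_mem (-ε) x'.2 (subset_affineSpan ℝ s hy)
    rwa [AffineMap.lineMap_apply, vsub_eq_sub, vadd_eq_add, neg_smul, neg_add_eq_sub] at this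
  let φ : ℝ → affineSpan ℝ s := fun ε => ⟨x' - ε • (y - x'), hmem ε⟩
  have hφ : Continuous φ := by
    refine Continuous.subtype_mk ?_ _
    fun_prop
  have h0 : φ 0 = x' := by ext; simp [φ]
  have hnear : ∀ᶠ ε in nhds (0 : ℝ), φ ε ∈ interior ((↑) ⁻¹' s : Set (affineSpan ℝ s)) :=
    hφ.continuousAt.eventually_mem (isOpen_interior.mem_nhds (by rwa [h0]))
  obtain ⟨δ, hδ, hball⟩ := Metric.eventually_nhds_iff.mp hnear
  refine ⟨δ / 2, by positivity, ?_⟩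
  have := interior_subset (hball (y := δ / 2) (by
    rw [Real.dist_eq, sub_zero, abs_of_pos (by positivity)]; linarith))
  exact this

/-- Proper separation of a convex set from the origin: the functional is nonpositive on `M` without
vanishing identically on it. Working in the span of `M`, the hull of `M ∪ {0}` has nonempty
interior, and the origin cannot be an interior point. -/
theorem Convex.exists_inner_nonpos_of_zero_notMem {E : Type*} [NormedAddCommGroup E]
    [InnerProductSpace ℝ E] [FiniteDimensional ℝ E] {M : Set E} (hM : Convex ℝ M)
    (hne : M.Nonempty) (h0 : (0 : E) ∉ M) :
    ∃ y : E, (∀ m ∈ M, ⟪m, y⟫_ℝ ≤ 0) ∧ ∃ m ∈ M, ⟪m, y⟫_ℝ ≠ 0 := by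
  set W : Submodule ℝ E := Submodule.span ℝ M with hW
  set N : Set W := (↑) ⁻¹' M with hN
  have hMW : ∀ m ∈ M, m ∈ W := fun m hm => Submodule.subset_span hm
  have hNconv : Convex ℝ N := hM.linear_preimage W.subtype
  have hNne : N.Nonempty := by
    obtain ⟨m, hm⟩ := hne
    exact ⟨⟨m, hMW m hm⟩, hm⟩
  have hspan : Submodule.span ℝ N = ⊤ := Submodule.span_span_coe_preimage
  have hint : (interior (convexHull ℝ (insert (0 : W) N))).Nonempty := by
    rw [interior_convexHull_nonempty_iff_affineSpan_eq_top]
    apply SetLike.coe_injective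
    rw [affineSpan_insert_zero, hspan]
    simp
  have hzero : (0 : W) ∉ interior (convexHull ℝ (insert (0 : W) N)) := by
    intro h
    obtain ⟨m, hm⟩ := hNne
    have hcont : Continuous fun ε : ℝ => -ε • m := by fun_prop
    have hnear : ∀ᶠ ε in nhds (0 : ℝ),
        -ε • m ∈ interior (convexHull ℝ (insert (0 : W) N)) :=
      hcont.continuousAt.eventually_mem (isOpen_interior.mem_nhds (by simpa using h))
    obtain ⟨δ, hδ, hball⟩ := Metric.eventually_nhds_iff.mp hnear
    have hmem := interior_subset (hball (y := δ / 2) (by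
      rw [Real.dist_eq, sub_zero, abs_of_pos (by positivity)]; linarith))
    rw [convexHull_insert ⟨m, hm⟩, hNconv.convexHull_eq, convexJoin_singleton_left] at hmem
    simp only [Set.mem_iUnion, exists_prop] at hmem
    obtain ⟨m', hm', a, c, ha, hc, hac, heq⟩ := hmem
    rw [smul_zero, zero_add] at heq
    -- a convex combination of `m` and `m'` vanishes
    have hpos : 0 < δ / 2 + c := by positivity
    have := hNconv hm hm' (a := (δ / 2) / (δ / 2 + c)) (b := c / (δ / 2 + c)) (by positivity)
      (by positivity) (by field_simp)
    have hz : ((δ / 2) / (δ / 2 + c)) • m + (c / (δ / 2 + c)) • m' = 0 := by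
      rw [div_eq_inv_mul, div_eq_inv_mul c, mul_smul, mul_smul, ← smul_add, heq, neg_smul,
        add_neg_cancel, smul_zero]
    rw [hz] at this
    exact h0 this
  obtain ⟨f, hf, hle⟩ := geometric_hahn_banach_of_nonempty_interior_point
    (convex_convexHull ℝ _) hzero hint
  set w : W := (InnerProductSpace.toDual ℝ W).symm f with hw
  have hfw : ∀ v : W, ⟪(v : E), (w : E)⟫_ℝ = f v := fun v => by
    rw [← Submodule.coe_inner, real_inner_comm, hw, InnerProductSpace.toDual_symm_apply]
  refine ⟨w, fun m hm => ?_, ?_⟩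
  · rw [hfw ⟨m, hMW m hm⟩]
    simpa using hle ⟨m, hMW m hm⟩
      (subset_convexHull ℝ _ (Set.mem_insert_of_mem _ (show (⟨m, hMW m hm⟩ : W) ∈ N from hm)))
  · by_contra! hcon
    apply hf
    ext v
    have hv : v ∈ Submodule.span ℝ N := hspan ▸ Submodule.mem_top
    have hker : Submodule.span ℝ N ≤ LinearMap.ker (f : W →ₗ[ℝ] ℝ) := by
      rw [Submodule.span_le]
      intro n hn
      have := hcon n hn
      rw [hfw] at this
      simpa using this
    simpa using hker hv

/-- A linear functional that is nonnegative on a set and vanishes at a relative interior point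
vanishes on the whole set. -/
theorem LinearMap.eq_zero_of_mem_intrinsicInterior {E : Type*} [NormedAddCommGroup E]
    [NormedSpace ℝ E] {s : Set E} (f : E →ₗ[ℝ] ℝ) {x₀ : E} (hx₀ : x₀ ∈ intrinsicInterior ℝ s)
    (hs : ∀ x ∈ s, 0 ≤ f x) (h₀ : f x₀ = 0) {x : E} (hx : x ∈ s) : f x = 0 := by
  obtain ⟨ε, hε, hmem⟩ := exists_sub_smul_mem_of_mem_intrinsicInterior hx₀ hx
  have h := hs _ hmem
  rw [map_sub, map_smul, map_sub, h₀, smul_eq_mul] at h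
  have := hs x hx
  nlinarith

/-! ### Gauges and polars in real terms -/

theorem ENNReal.ofReal_le_ofReal_mul_iff {a μ : ℝ} (hμ : 0 < μ) {c : ℝ≥0∞} :
    ENNReal.ofReal a ≤ ENNReal.ofReal μ * c ↔ (c ≠ ⊤ → a ≤ μ * c.toReal) := by
  by_cases hc : c = ⊤
  · simp [hc, ENNReal.mul_top (ENNReal.ofReal_pos.mpr hμ).ne']
  · have h : ENNReal.ofReal μ * c = ENNReal.ofReal (μ * c.toReal) := by
      rw [ENNReal.ofReal_mul hμ.le, ENNReal.ofReal_toReal hc]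
    rw [h, ENNReal.ofReal_le_ofReal_iff (by positivity)]
    simp [hc]

/-- The polar inequality, as a statement about real numbers on the effective domain. The case
`r = 0` is included, although the infimum defining the polar runs over positive multipliers. -/
theorem polarGauge_le_ofReal_iff {E : Type*} [NormedAddCommGroup E] [InnerProductSpace ℝ E]
    {κ : E → ℝ≥0∞} {y : E} {r : ℝ} (hr : 0 ≤ r) :
    polarGauge κ y ≤ ENNReal.ofReal r ↔ ∀ x, κ x ≠ ⊤ → ⟪x, y⟫_ℝ ≤ r * (κ x).toReal := by
  constructor
  · intro h x hx
    refine le_of_forall_pos_lt_add fun ε hε => ?_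
    set δ := ε / ((κ x).toReal + 1) with hδ
    have hκ0 : 0 ≤ (κ x).toReal := ENNReal.toReal_nonneg
    have hδ0 : 0 < δ := by positivity
    have hlt : polarGauge κ y < ENNReal.ofReal (r + δ) :=
      h.trans_lt ((ENNReal.ofReal_lt_ofReal_iff (by positivity)).mpr (by linarith))
    simp only [polarGauge, iInf_lt_iff] at hlt
    obtain ⟨μ, ⟨hμ, hall⟩, hlt⟩ := hlt
    have h1 := (ENNReal.ofReal_le_ofReal_mul_iff hμ).mp (hall x) hx
    have h2 : μ < r + δ := (ENNReal.ofReal_lt_ofReal_iff (by positivity)).mp hlt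
    have h3 : δ * (κ x).toReal < ε := by
      rw [hδ, div_mul_eq_mul_div, div_lt_iff₀ (by positivity)]
      nlinarith
    nlinarith
  · intro h
    refine ENNReal.le_of_forall_pos_le_add fun ε hε _ => ?_
    have hε' : (0 : ℝ) < ε := hε
    have hpos : 0 < r + ε := by linarith
    have hall : ∀ x, ENNReal.ofReal ⟪x, y⟫_ℝ ≤ ENNReal.ofReal (r + ε) * κ x := fun x => by
      refine (ENNReal.ofReal_le_ofReal_mul_iff hpos).mpr fun hx => ?_
      have := h x hx
      have h0 : 0 ≤ (κ x).toReal := ENNReal.toReal_nonneg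
      nlinarith
    have hle : polarGauge κ y ≤ ENNReal.ofReal (r + ε) := iInf₂_le_of_le _ ⟨hpos, hall⟩ le_rfl
    rwa [ENNReal.ofReal_add hr hε'.le, ENNReal.ofReal_coe_nnreal] at hle

theorem inner_le_polarGauge_mul {E : Type*} [NormedAddCommGroup E] [InnerProductSpace ℝ E]
    {κ : E → ℝ≥0∞} {x y : E} (hy : polarGauge κ y ≠ ⊤) (hx : κ x ≠ ⊤) :
    ⟪x, y⟫_ℝ ≤ (polarGauge κ y).toReal * (κ x).toReal :=
  (polarGauge_le_ofReal_iff ENNReal.toReal_nonneg).mp (ENNReal.ofReal_toReal hy).ge x hx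

namespace IsGauge

variable {E : Type*} [AddCommGroup E] [Module ℝ E] {κ : E → ℝ≥0∞}

theorem smul_ne_top (h : IsGauge κ) {t : ℝ} (ht : 0 < t) {x : E} (hx : κ x ≠ ⊤) :
    κ (t • x) ≠ ⊤ := by
  rw [h.map_smul t x ht]
  exact ENNReal.mul_ne_top ENNReal.ofReal_ne_top hx

theorem toReal_smul (h : IsGauge κ) {t : ℝ} (ht : 0 < t) (x : E) :
    (κ (t • x)).toReal = t * (κ x).toReal := by
  rw [h.map_smul t x ht, ENNReal.toReal_mul, ENNReal.toReal_ofReal ht.le]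

theorem combo_ne_top (h : IsGauge κ) {a c : ℝ} (ha : 0 ≤ a) (hc : 0 ≤ c) (hac : a + c = 1)
    {x y : E} (hx : κ x ≠ ⊤) (hy : κ y ≠ ⊤) : κ (a • x + c • y) ≠ ⊤ :=
  ne_top_of_le_ne_top (ENNReal.add_ne_top.mpr ⟨ENNReal.mul_ne_top ENNReal.ofReal_ne_top hx,
    ENNReal.mul_ne_top ENNReal.ofReal_ne_top hy⟩) (h.convex x y a c ha hc hac)

theorem toReal_combo_le (h : IsGauge κ) {a c : ℝ} (ha : 0 ≤ a) (hc : 0 ≤ c) (hac : a + c = 1)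
    {x y : E} (hx : κ x ≠ ⊤) (hy : κ y ≠ ⊤) :
    (κ (a • x + c • y)).toReal ≤ a * (κ x).toReal + c * (κ y).toReal := by
  have hx' : ENNReal.ofReal a * κ x ≠ ⊤ := ENNReal.mul_ne_top ENNReal.ofReal_ne_top hx
  have hy' : ENNReal.ofReal c * κ y ≠ ⊤ := ENNReal.mul_ne_top ENNReal.ofReal_ne_top hy
  have := ENNReal.toReal_mono (ENNReal.add_ne_top.mpr ⟨hx', hy'⟩) (h.convex x y a c ha hc hac)
  rwa [ENNReal.toReal_add hx' hy', ENNReal.toReal_mul, ENNReal.toReal_mul,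
    ENNReal.toReal_ofReal ha, ENNReal.toReal_ofReal hc] at this

end IsGauge

section PrimalObj

variable {E : Type*} [NormedAddCommGroup E] {κ : E → ℝ≥0∞} {α : ℝ}

theorem primalObj_ne_top_iff {x : E} : primalObj κ α x ≠ ⊤ ↔ κ x ≠ ⊤ := by
  simp [primalObj]

theorem toReal_primalObj (hα : 0 < α) {x : E} (hx : κ x ≠ ⊤) :
    (primalObj κ α x).toReal = (κ x).toReal + α * ‖x‖ := by
  rw [primalObj, ENNReal.toReal_add hx ENNReal.ofReal_ne_top,
    ENNReal.toReal_ofReal (by positivity)]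

theorem lowerSemicontinuous_primalObj (hκ : LowerSemicontinuous κ) :
    LowerSemicontinuous (primalObj κ α) := by
  have : Continuous fun x : E => ENNReal.ofReal (α * ‖x‖) :=
    ENNReal.continuous_ofReal.comp (by fun_prop)
  exact hκ.add this.lowerSemicontinuous

end PrimalObj

/-! ### The proximal map of a gauge -/

/-- The optimality conditions of the problem defining `prox_{tκ}(z)`: the point `p` has finite gauge
and `(z - p) / t` is a subgradient of `κ` at `p`. In particular `z - p` is the projection of `z`
onto the `t`-sublevel set of the polar of `κ`. -/
structure IsProxPoint {E : Type*} [NormedAddCommGroup E] [InnerProductSpace ℝ E]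
    (κ : E → ℝ≥0∞) (t : ℝ) (z p : E) : Prop where
  ne_top : κ p ≠ ⊤
  inner_le : ∀ x, κ x ≠ ⊤ → ⟪x, z - p⟫_ℝ ≤ t * (κ x).toReal
  inner_eq : ⟪p, z - p⟫_ℝ = t * (κ p).toReal

section Prox

variable {E : Type*} [NormedAddCommGroup E] [InnerProductSpace ℝ E] {κ : E → ℝ≥0∞}

theorem proxSet_nonempty [FiniteDimensional ℝ E] (hκ : IsGauge κ) (hκc : LowerSemicontinuous κ)
    {t : ℝ} (ht : 0 < t) (z : E) : (proxSet t κ z).Nonempty := by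
  have hcont : Continuous fun w : E => ENNReal.ofReal (1 / (2 * t) * ‖z - w‖ ^ 2) :=
    ENNReal.continuous_ofReal.comp (by fun_prop)
  obtain ⟨p, -, hp⟩ := LowerSemicontinuous.exists_isMinOn_of_norm_le
    (hκc.add hcont.lowerSemicontinuous) isClosed_univ (Set.mem_univ (0 : E)) (R := ‖z‖ + ‖z‖)
    (fun x _ hx => by
      simp only [hκ.map_zero, zero_add, sub_zero] at hx
      have h1 := (ENNReal.ofReal_le_ofReal_iff (by positivity)).mp (le_add_self.trans hx)
      have h2 : ‖z - x‖ ^ 2 ≤ ‖z‖ ^ 2 := le_of_mul_le_mul_left h1 (by positivity)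
      have h3 : ‖z - x‖ ≤ ‖z‖ := le_of_sq_le_sq h2 (norm_nonneg _)
      have h4 : ‖x‖ ≤ ‖z‖ + ‖z - x‖ := by
        simpa using norm_sub_le z (z - x)
      linarith)
  exact ⟨p, hp⟩

theorem IsProxPoint.of_mem_proxSet (hκ : IsGauge κ) {t : ℝ} (ht : 0 < t) {z p : E}
    (hp : p ∈ proxSet t κ z) : IsProxPoint κ t z p := by
  have hmin : ∀ w, κ p + ENNReal.ofReal (1 / (2 * t) * ‖z - p‖ ^ 2) ≤
      κ w + ENNReal.ofReal (1 / (2 * t) * ‖z - w‖ ^ 2) := fun w => hp (Set.mem_univ w)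
  have hpt : κ p ≠ ⊤ := by
    refine ne_top_of_le_ne_top ?_ (le_self_add.trans (hmin 0))
    simp [hκ.map_zero]
  have hreal : ∀ w, κ w ≠ ⊤ → 2 * t * (κ p).toReal + ‖z - p‖ ^ 2 ≤
      2 * t * (κ w).toReal + ‖z - w‖ ^ 2 := fun w hw => by
    have h := ENNReal.toReal_mono (ENNReal.add_ne_top.mpr ⟨hw, ENNReal.ofReal_ne_top⟩) (hmin w)
    rw [ENNReal.toReal_add hpt ENNReal.ofReal_ne_top, ENNReal.toReal_add hw ENNReal.ofReal_ne_top,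
      ENNReal.toReal_ofReal (by positivity), ENNReal.toReal_ofReal (by positivity)] at h
    have h' := mul_le_mul_of_nonneg_left h (by positivity : 0 ≤ 2 * t)
    field_simp at h'
    linarith
  -- the variational inequality, from the minimality of `p` along the segment to `x`
  have hvar : ∀ x, κ x ≠ ⊤ → ⟪x - p, z - p⟫_ℝ ≤ t * ((κ x).toReal - (κ p).toReal) := by
    intro x hx
    have hs : ∀ s : ℝ, 0 < s → s ≤ 1 → ⟪x - p, z - p⟫_ℝ ≤
        t * ((κ x).toReal - (κ p).toReal) + s * (‖x - p‖ ^ 2 / 2) := by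
      intro s hs0 hs1
      have h1 := hreal _ (hκ.combo_ne_top (sub_nonneg.mpr hs1) hs0.le (by ring) hpt hx)
      have h2 := hκ.toReal_combo_le (sub_nonneg.mpr hs1) hs0.le (by ring) hpt hx
      have h3 : ‖z - ((1 - s) • p + s • x)‖ ^ 2 =
          ‖z - p‖ ^ 2 - 2 * (s * ⟪x - p, z - p⟫_ℝ) + s ^ 2 * ‖x - p‖ ^ 2 := by
        have : z - ((1 - s) • p + s • x) = (z - p) - s • (x - p) := by module
        rw [this, norm_sub_sq_real, real_inner_smul_right, norm_smul, mul_pow, Real.norm_eq_abs,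
          sq_abs, real_inner_comm]
      rw [h3] at h1
      have h4 := mul_le_mul_of_nonneg_left h2 ht.le
      have h5 : s * ⟪x - p, z - p⟫_ℝ ≤
          s * (t * ((κ x).toReal - (κ p).toReal) + s * (‖x - p‖ ^ 2 / 2)) := by nlinarith
      exact le_of_mul_le_mul_left h5 hs0
    refine le_of_forall_pos_le_add fun ε hε => ?_
    set c := ‖x - p‖ ^ 2 / 2 with hc
    have hc0 : 0 ≤ c := by positivity
    refine (hs (min 1 (ε / (c + 1))) (by positivity) (min_le_left _ _)).trans ?_
    have : min 1 (ε / (c + 1)) * c ≤ ε / (c + 1) * (c + 1) :=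
      mul_le_mul (min_le_right _ _) (by linarith) hc0 (by positivity)
    rw [div_mul_cancel₀ _ (by positivity)] at this
    linarith
  -- testing with `0` and `2 • p` pins down the inner product, by homogeneity
  have h0 := hvar 0 (by simp [hκ.map_zero])
  have h2 := hvar ((2 : ℝ) • p) (hκ.smul_ne_top two_pos hpt)
  rw [hκ.toReal_smul two_pos, two_smul, add_sub_cancel_right] at h2
  rw [hκ.map_zero, ENNReal.toReal_zero, zero_sub, inner_neg_left] at h0
  have heq : ⟪p, z - p⟫_ℝ = t * (κ p).toReal := by linarith
  refine ⟨hpt, fun x hx => ?_, heq⟩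
  have := hvar x hx
  rw [inner_sub_left, heq] at this
  linarith

namespace IsProxPoint

/-- Dependence of the proximal point on the point and on the parameter, from the monotonicity of
the subdifferential. -/
theorem norm_sub_le {t₁ t₂ : ℝ} (ht₁ : 0 < t₁) (ht₂ : 0 < t₂) {z₁ z₂ p₁ p₂ : E}
    (h₁ : IsProxPoint κ t₁ z₁ p₁) (h₂ : IsProxPoint κ t₂ z₂ p₂) :
    ‖p₁ - p₂‖ ≤ ‖z₁ - z₂‖ + |t₁ - t₂| * (‖z₂ - p₂‖ / t₂) := by
  set q₂ : E := t₂⁻¹ • (z₂ - p₂) with hq₂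
  have hq : z₂ - p₂ = t₂ • q₂ := by rw [hq₂, smul_inv_smul₀ ht₂.ne']
  have hnq : ‖q₂‖ = ‖z₂ - p₂‖ / t₂ := by
    rw [hq₂, norm_smul, norm_inv, Real.norm_eq_abs, abs_of_pos ht₂, div_eq_inv_mul]
  have ha := h₂.inner_le p₁ h₁.ne_top
  have hb := h₂.inner_eq
  rw [hq, real_inner_smul_right] at ha hb
  have ha' := le_of_mul_le_mul_left ha ht₂
  have hb' := mul_left_cancel₀ ht₂.ne' hb
  -- monotonicity of the subdifferential of `κ`, scaled by `t₁`
  have hmono : 0 ≤ ⟪p₁ - p₂, (z₁ - p₁) - t₁ • q₂⟫_ℝ := by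
    have e1 := h₁.inner_eq
    have e2 := h₁.inner_le p₂ h₂.ne_top
    rw [inner_sub_right, inner_sub_left, real_inner_smul_right, inner_sub_left]
    nlinarith
  have hvec : (z₁ - p₁) - t₁ • q₂ = ((z₁ - z₂) - (t₁ - t₂) • q₂) - (p₁ - p₂) := by
    rw [eq_add_of_sub_eq hq]; module
  rw [hvec, inner_sub_right, real_inner_self_eq_norm_sq] at hmono
  have hcs := real_inner_le_norm (p₁ - p₂) ((z₁ - z₂) - (t₁ - t₂) • q₂)
  have htri : ‖(z₁ - z₂) - (t₁ - t₂) • q₂‖ ≤ ‖z₁ - z₂‖ + |t₁ - t₂| * ‖q₂‖ := by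
    refine (_root_.norm_sub_le _ _).trans ?_
    rw [norm_smul, Real.norm_eq_abs]
  rw [← hnq]
  by_contra! hlt
  have hpos : 0 < ‖p₁ - p₂‖ := lt_of_le_of_lt (by positivity) hlt
  nlinarith

theorem eq {t : ℝ} (ht : 0 < t) {z p₁ p₂ : E} (h₁ : IsProxPoint κ t z p₁)
    (h₂ : IsProxPoint κ t z p₂) : p₁ = p₂ := by
  have := norm_sub_le ht ht h₁ h₂
  simpa [sub_eq_zero] using this

end IsProxPoint

theorem exists_proxSet_eq_singleton [FiniteDimensional ℝ E] (hκ : IsGauge κ)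
    (hκc : LowerSemicontinuous κ) {t : ℝ} (ht : 0 < t) (z : E) :
    ∃ p, proxSet t κ z = {p} ∧ IsProxPoint κ t z p := by
  obtain ⟨p, hp⟩ := proxSet_nonempty hκ hκc ht z
  refine ⟨p, Set.Subset.antisymm (fun p' hp' => ?_) (by simpa using hp), .of_mem_proxSet hκ ht hp⟩
  exact (IsProxPoint.of_mem_proxSet hκ ht hp').eq ht (.of_mem_proxSet hκ ht hp)

end Prox

/-! ### The polar envelope as the polar of the primal objective -/

section Envelope

variable {E : Type*} [NormedAddCommGroup E] [InnerProductSpace ℝ E] {κ : E → ℝ≥0∞} {α : ℝ}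

theorem IsProxPoint.norm_le (hα : 0 < α) {t : ℝ} (ht : 0 < t) {z p : E}
    (hp : IsProxPoint κ t z p) (hz : polarGauge (primalObj κ α) z ≤ ENNReal.ofReal t) :
    ‖p‖ ≤ α * t := by
  have h := (polarGauge_le_ofReal_iff ht.le).mp hz p (primalObj_ne_top_iff.mpr hp.ne_top)
  rw [toReal_primalObj hα hp.ne_top] at h
  have h' := hp.inner_eq
  rw [inner_sub_right, real_inner_self_eq_norm_sq] at h'
  by_contra! hlt
  have : 0 < ‖p‖ := lt_trans (by positivity) hlt
  nlinarith

/-- The polar of the sum `κ + α‖·‖` is the max-convolution of the polars. A vector `z` in the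
`μ`-sublevel set of the former splits as `(z - p) + p` with `p = prox_{μκ}(z)`. -/
theorem polarEnvelope_polarGauge [FiniteDimensional ℝ E] (hκ : IsGauge κ)
    (hκc : LowerSemicontinuous κ) (hα : 0 < α) :
    polarEnvelope (polarGauge κ) α = polarGauge (primalObj κ α) := by
  funext z
  apply le_antisymm
  · refine le_iInf₂ fun μ hμ => ?_
    have hz : polarGauge (primalObj κ α) z ≤ ENNReal.ofReal μ := iInf₂_le μ hμ
    obtain ⟨p, -, hp⟩ := exists_proxSet_eq_singleton hκ hκc hμ.1 z
    refine (iInf_le _ (z - p)).trans (max_le ?_ ?_)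
    · exact (polarGauge_le_ofReal_iff hμ.1.le).mpr hp.inner_le
    · refine ENNReal.ofReal_le_ofReal ?_
      rw [sub_sub_cancel, one_div, inv_mul_le_iff₀ hα]
      exact hp.norm_le hα hμ.1 hz
  · refine le_iInf fun w => ?_
    set m : ℝ≥0∞ := max (polarGauge κ w) (ENNReal.ofReal (1 / α * ‖z - w‖)) with hm
    by_cases hmt : m = ⊤
    · rw [hmt]; exact le_top
    rw [← ENNReal.ofReal_toReal hmt]
    have h1 : polarGauge κ w ≤ ENNReal.ofReal m.toReal := by
      rw [ENNReal.ofReal_toReal hmt]; exact le_max_left _ _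
    have h2 : 1 / α * ‖z - w‖ ≤ m.toReal := by
      rw [← ENNReal.ofReal_le_iff_le_toReal hmt]; exact le_max_right _ _
    rw [one_div, inv_mul_le_iff₀ hα] at h2
    refine (polarGauge_le_ofReal_iff ENNReal.toReal_nonneg).mpr fun x hx => ?_
    rw [primalObj_ne_top_iff] at hx
    rw [toReal_primalObj hα hx]
    have h3 := (polarGauge_le_ofReal_iff ENNReal.toReal_nonneg).mp h1 x hx
    have h4 := real_inner_le_norm x (z - w)
    rw [inner_sub_right] at h4
    nlinarith [mul_le_mul_of_nonneg_left h2 (norm_nonneg x)]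

theorem polarGauge_primalObj_le_add (hα : 0 < α) {z w : E} {r : ℝ} (hr : 0 ≤ r)
    (hw : polarGauge (primalObj κ α) w ≤ ENNReal.ofReal r) :
    polarGauge (primalObj κ α) z ≤ ENNReal.ofReal (r + ‖z - w‖ / α) := by
  refine (polarGauge_le_ofReal_iff (by positivity)).mpr fun x hx => ?_
  have h1 := (polarGauge_le_ofReal_iff hr).mp hw x hx
  rw [primalObj_ne_top_iff] at hx
  rw [toReal_primalObj hα hx] at h1 ⊢
  have h2 := real_inner_le_norm x (z - w)
  rw [inner_sub_right] at h2
  have h3 : ‖x‖ * ‖z - w‖ = ‖z - w‖ / α * (α * ‖x‖) := by field_simp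
  have h4 : 0 ≤ ‖z - w‖ / α * (κ x).toReal := mul_nonneg (by positivity) ENNReal.toReal_nonneg
  nlinarith

theorem polarGauge_primalObj_ne_top (hα : 0 < α) (z : E) :
    polarGauge (primalObj κ α) z ≠ ⊤ := by
  refine ne_top_of_le_ne_top ENNReal.ofReal_ne_top
    (polarGauge_primalObj_le_add hα (w := 0) le_rfl ?_)
  exact (polarGauge_le_ofReal_iff le_rfl).mpr fun x _ => by simp

theorem lipschitzWith_toReal_polarGauge_primalObj (hα : 0 < α) :
    LipschitzWith (1 / α).toNNReal fun z => (polarGauge (primalObj κ α) z).toReal := by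
  refine LipschitzWith.of_le_add_mul _ fun z w => ?_
  have h := polarGauge_primalObj_le_add hα (z := z) ENNReal.toReal_nonneg
    (ENNReal.ofReal_toReal (polarGauge_primalObj_ne_top (κ := κ) hα w)).ge
  have := ENNReal.toReal_le_of_le_ofReal (by positivity) h
  rwa [dist_eq_norm, Real.coe_toNNReal _ (by positivity), one_div_mul_eq_div]

theorem IsProxPoint.norm_eq (hα : 0 < α) {t : ℝ} (ht : 0 < t) {z p : E}
    (hp : IsProxPoint κ t z p) (hz : (polarGauge (primalObj κ α) z).toReal = t) :
    ‖p‖ = α * t := by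
  have htop := polarGauge_primalObj_ne_top (κ := κ) hα z
  refine (hp.norm_le hα ht (by rw [← hz, ENNReal.ofReal_toReal htop])).antisymm ?_
  by_contra! hlt
  -- if `‖p‖ < α t`, then `z = s • q + ((t - s) • q + p)` shows that the value at `z` is at most `s`
  set q : E := t⁻¹ • (z - p) with hq
  set s : ℝ := (t * ‖q‖ + ‖p‖) / (α + ‖q‖) with hs
  have hs0 : 0 ≤ s := by positivity
  have hst : s < t := by
    rw [hs, div_lt_iff₀ (by positivity)]
    nlinarith
  have hsum : (t - s) * ‖q‖ + ‖p‖ = α * s := by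
    rw [hs]; field_simp; ring
  refine absurd (ENNReal.toReal_le_of_le_ofReal hs0 ?_) (not_le.mpr (hz ▸ hst))
  refine (polarGauge_le_ofReal_iff hs0).mpr fun x hx => ?_
  rw [primalObj_ne_top_iff] at hx
  rw [toReal_primalObj hα hx]
  have h1 := hp.inner_le x hx
  have htq : z - p = t • q := by rw [hq, smul_inv_smul₀ ht.ne']
  rw [htq, real_inner_smul_right] at h1
  have h1' := le_of_mul_le_mul_left h1 ht
  have hz' : z = s • q + ((t - s) • q + p) := by rw [eq_add_of_sub_eq htq]; module
  have h2 : ‖(t - s) • q + p‖ ≤ α * s := by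
    rw [← hsum]
    refine (norm_add_le _ _).trans ?_
    rw [norm_smul, Real.norm_eq_abs, abs_of_pos (by linarith)]
  have h3 := (real_inner_le_norm x _).trans (mul_le_mul_of_nonneg_left h2 (norm_nonneg x))
  have h4 : ⟪x, z⟫_ℝ = s * ⟪x, q⟫_ℝ + ⟪x, (t - s) • q + p⟫_ℝ := by
    conv_lhs => rw [hz']
    rw [inner_add_right, real_inner_smul_right]
  nlinarith [mul_le_mul_of_nonneg_left h1' hs0]

end Envelope

/-! ### Smoothness of the polar envelope -/

theorem LocallyLipschitzOn.contDiffAt_comp {α F G : Type*} [PseudoEMetricSpace α]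
    [NormedAddCommGroup F] [NormedSpace ℝ F] [NormedAddCommGroup G] [NormedSpace ℝ G]
    {s : Set α} {f : α → F} {Φ : F → G} (hf : LocallyLipschitzOn s f)
    (hΦ : ∀ x ∈ s, ContDiffAt ℝ 1 Φ (f x)) : LocallyLipschitzOn s fun x => Φ (f x) := by
  intro x hx
  obtain ⟨K, t, ht, hK⟩ := hf hx
  obtain ⟨K', u, hu, hK'⟩ := (hΦ x hx).exists_lipschitzOnWith
  refine ⟨K' * K, t ∩ f ⁻¹' u, Filter.inter_mem ht (hf.continuousOn x hx hu), ?_⟩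
  exact hK'.comp (hK.mono Set.inter_subset_left) fun w hw => hw.2

theorem LocallyLipschitzOn.comp_lipschitzWith {α β γ : Type*} [PseudoEMetricSpace α]
    [PseudoEMetricSpace β] [PseudoEMetricSpace γ] {s : Set α} {t : Set β} {f : β → γ} {g : α → β}
    {K : NNReal} (hf : LocallyLipschitzOn t f) (hg : LipschitzWith K g) (hst : Set.MapsTo g s t) :
    LocallyLipschitzOn s fun x => f (g x) := by
  intro x hx
  obtain ⟨K', u, hu, hK'⟩ := hf (hst hx)
  refine ⟨K' * K, g ⁻¹' u, ?_, hK'.comp hg.lipschitzOnWith fun w hw => hw⟩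
  exact (hg.continuous.continuousWithinAt.tendsto_nhdsWithin hst) hu

/-- A function with a continuous selection of subgradients on an open set is differentiable there,
since `0 ≤ F w - F y - ⟪G y, w - y⟫ ≤ ⟪G w - G y, w - y⟫`. -/
theorem hasFDerivAt_of_continuousOn_subgradient {E : Type*} [NormedAddCommGroup E]
    [InnerProductSpace ℝ E] {U : Set E} (hU : IsOpen U) {F : E → ℝ} {G : E → E}
    (hG : ContinuousOn G U) (hsub : ∀ y ∈ U, ∀ w ∈ U, F y + ⟪G y, w - y⟫_ℝ ≤ F w)
    {y : E} (hy : y ∈ U) : HasFDerivAt F (innerSL ℝ (G y)) y := by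
  rw [hasFDerivAt_iff_isLittleO, Asymptotics.isLittleO_iff]
  intro c hc
  have hGy := (hG.continuousAt (hU.mem_nhds hy)).eventually (Metric.ball_mem_nhds (G y) hc)
  filter_upwards [hGy, hU.mem_nhds hy] with w hw hwU
  have h1 := hsub y hy w hwU
  have h2 := hsub w hwU y hy
  have h3 := real_inner_le_norm (G w - G y) (w - y)
  have h4 : ‖G w - G y‖ ≤ c := by simpa [dist_eq_norm] using (Metric.mem_ball.mp hw).le
  have h5 := mul_le_mul_of_nonneg_right h4 (norm_nonneg (w - y))
  rw [← neg_sub w y, inner_neg_right] at h2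
  rw [inner_sub_left] at h3
  rw [innerSL_apply_apply, Real.norm_eq_abs, abs_le]
  constructor <;> nlinarith [norm_nonneg (w - y)]

/-- Where the polar of `φ = κ + α‖·‖` is positive, `p / φ(p)` with `p = prox_{tκ}(z)`, `t = φ°(z)`,
is a subgradient of `φ°` at `z`, and it is locally Lipschitz in `z`. Here `φ(p) = ⟪p, z⟫ / t`. -/
theorem exists_locallyLipschitzOn_subgradient {E : Type*} [NormedAddCommGroup E]
    [InnerProductSpace ℝ E] [FiniteDimensional ℝ E] {κ : E → ℝ≥0∞} {α : ℝ} (hκ : IsGauge κ)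
    (hκc : LowerSemicontinuous κ) (hα : 0 < α) :
    ∃ g : E → E, (∀ z, 0 < (polarGauge (primalObj κ α) z).toReal →
        ⟪g z, z⟫_ℝ = (polarGauge (primalObj κ α) z).toReal ∧
        ∀ w, ⟪g z, w⟫_ℝ ≤ (polarGauge (primalObj κ α) w).toReal) ∧
      LocallyLipschitzOn {z | 0 < (polarGauge (primalObj κ α) z).toReal} g := by
  set h : E → ℝ := fun z => (polarGauge (primalObj κ α) z).toReal with hh
  have hLip : LipschitzWith (1 / α).toNNReal h := lipschitzWith_toReal_polarGauge_primalObj hα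
  have hP : ∀ z, ∃ p, 0 < h z → IsProxPoint κ (h z) z p := fun z => by
    by_cases hz : 0 < h z
    · obtain ⟨p, -, hp⟩ := exists_proxSet_eq_singleton hκ hκc hz z
      exact ⟨p, fun _ => hp⟩
    · exact ⟨0, fun hz' => absurd hz' hz⟩
  choose P hP using hP
  have hnorm : ∀ z, 0 < h z → ‖P z‖ = α * h z := fun z hz => (hP z hz).norm_eq hα hz rfl
  have hval : ∀ z, 0 < h z → ⟪P z, z⟫_ℝ = h z * (primalObj κ α (P z)).toReal := fun z hz => by
    have := (hP z hz).inner_eq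
    rw [inner_sub_right, real_inner_self_eq_norm_sq] at this
    have hn := hnorm z hz
    rw [toReal_primalObj hα (hP z hz).ne_top, hn]
    rw [hn] at this
    linarith
  have hφ : ∀ z, 0 < h z → 0 < (primalObj κ α (P z)).toReal := fun z hz => by
    rw [toReal_primalObj hα (hP z hz).ne_top, hnorm z hz]
    positivity
  have hipos : ∀ z, 0 < h z → 0 < ⟪P z, z⟫_ℝ := fun z hz => by
    rw [hval z hz]; exact mul_pos hz (hφ z hz)
  refine ⟨fun z => (h z / ⟪P z, z⟫_ℝ) • P z, fun z hz => ⟨?_, fun w => ?_⟩, ?_⟩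
  · rw [real_inner_smul_left, div_mul_cancel₀ _ (hipos z hz).ne']
  · rw [real_inner_smul_left, hval z hz, div_mul_cancel_left₀ (ne_of_gt hz),
      inv_mul_le_iff₀ (hφ z hz), mul_comm]
    exact inner_le_polarGauge_mul (polarGauge_primalObj_ne_top hα w)
      (primalObj_ne_top_iff.mpr (hP z hz).ne_top)
  · have hLL : LocallyLipschitzOn {z | 0 < h z} fun z => (h z, P z, z) := by
      intro z₀ hz₀
      have hz₀' : 0 < h z₀ := hz₀
      have hev : ∀ᶠ z in nhds z₀, h z₀ / 2 < h z ∧ ‖z‖ < ‖z₀‖ + 1 :=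
        (hLip.continuous.continuousAt.eventually (lt_mem_nhds (half_lt_self hz₀'))).and
          (continuous_norm.continuousAt.eventually (gt_mem_nhds (lt_add_one _)))
      have hK : 0 ≤ 1 + 1 / α * ((‖z₀‖ + 1) / (h z₀ / 2) + α) := by positivity
      have hPLip : LipschitzOnWith (1 + 1 / α * ((‖z₀‖ + 1) / (h z₀ / 2) + α)).toNNReal P
          {z | h z₀ / 2 < h z ∧ ‖z‖ < ‖z₀‖ + 1} := by
        refine LipschitzOnWith.of_dist_le_mul fun z₁ hz₁ z₂ hz₂ => ?_
        have h1 : 0 < h z₁ := (half_pos hz₀').trans hz₁.1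
        have h2 : 0 < h z₂ := (half_pos hz₀').trans hz₂.1
        have hd := (hP z₁ h1).norm_sub_le h1 h2 (hP z₂ h2)
        have hh : |h z₁ - h z₂| ≤ 1 / α * ‖z₁ - z₂‖ := by
          have := hLip.dist_le_mul z₁ z₂
          rwa [Real.dist_eq, dist_eq_norm, Real.coe_toNNReal _ (by positivity)] at this
        have hq : ‖z₂ - P z₂‖ / h z₂ ≤ (‖z₀‖ + 1) / (h z₀ / 2) + α := by
          have ht : ‖z₂ - P z₂‖ ≤ (‖z₀‖ + 1) + α * h z₂ :=
            (_root_.norm_sub_le _ _).trans (add_le_add hz₂.2.le (hnorm z₂ h2).le)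
          calc ‖z₂ - P z₂‖ / h z₂ ≤ ((‖z₀‖ + 1) + α * h z₂) / h z₂ := by gcongr
            _ = (‖z₀‖ + 1) / h z₂ + α := by field_simp
            _ ≤ _ := by gcongr; exact hz₂.1.le
        rw [Real.coe_toNNReal _ hK, dist_eq_norm, dist_eq_norm]
        have := mul_le_mul hh hq (by positivity) (by positivity)
        linarith
      exact ⟨_, _, mem_nhdsWithin_of_mem_nhds hev,
        hLip.lipschitzOnWith.prodMk (hPLip.prodMk LipschitzWith.id.lipschitzOnWith)⟩
    refine hLL.contDiffAt_comp (Φ := fun v : ℝ × E × E => (v.1 / ⟪v.2.1, v.2.2⟫_ℝ) • v.2.1)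
      fun z hz => ?_
    have hne : ⟪P z, z⟫_ℝ ≠ 0 := (hipos z hz).ne'
    refine ContDiffAt.smul (ContDiffAt.div contDiffAt_fst ?_ hne) (by fun_prop)
    exact ContDiffAt.inner ℝ (by fun_prop) (by fun_prop)

/-! ### Primal attainment and the dual constraint -/

theorem isGauge_primalObj {X : Type*} [NormedAddCommGroup X] [InnerProductSpace ℝ X]
    {κ : X → ℝ≥0∞} {α : ℝ} (hκ : IsGauge κ) (hα : 0 < α) : IsGauge (primalObj κ α) where
  map_zero := by simp [primalObj, hκ.map_zero]
  map_smul t x ht := by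
    rw [primalObj, primalObj, hκ.map_smul t x ht, mul_add, ← ENNReal.ofReal_mul ht.le, norm_smul,
      Real.norm_eq_abs, abs_of_pos ht, mul_left_comm]
  convex x y a c ha hc hac := by
    have h1 : ENNReal.ofReal (α * ‖a • x + c • y‖) ≤
        ENNReal.ofReal a * ENNReal.ofReal (α * ‖x‖) +
          ENNReal.ofReal c * ENNReal.ofReal (α * ‖y‖) := by
      rw [← ENNReal.ofReal_mul ha, ← ENNReal.ofReal_mul hc,
        ← ENNReal.ofReal_add (by positivity) (by positivity)]
      refine ENNReal.ofReal_le_ofReal ?_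
      have := norm_add_le (a • x) (c • y)
      rw [norm_smul, norm_smul, Real.norm_eq_abs, Real.norm_eq_abs, abs_of_nonneg ha,
        abs_of_nonneg hc] at this
      nlinarith
    refine (add_le_add (hκ.convex x y a c ha hc hac) h1).trans_eq ?_
    simp only [primalObj]
    ring

theorem IsOptSol.optValue_eq {E : Type*} {S : Set E} {f : E → ℝ≥0∞} {x : E}
    (hx : IsOptSol S f x) : optValue S f = f x :=
  (iInf₂_le x hx.1).antisymm (le_iInf₂ fun _ hw => hx.2 hw)

theorem convex_constraintSet {Y : Type*} [NormedAddCommGroup Y] [InnerProductSpace ℝ Y]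
    {ρ : Y → ℝ≥0∞} (hρ : IsGauge ρ) (b : Y) (σ : ℝ) : Convex ℝ (constraintSet ρ b σ) := by
  intro u hu v hv a c ha hc hac
  have h : b - (a • u + c • v) = a • (b - u) + c • (b - v) := by
    rw [smul_sub, smul_sub, sub_add_sub_comm, ← add_smul, hac, one_smul]
  rw [constraintSet, Set.mem_ofPred_eq, h]
  calc ρ (a • (b - u) + c • (b - v))
      ≤ ENNReal.ofReal a * ρ (b - u) + ENNReal.ofReal c * ρ (b - v) := hρ.convex _ _ _ _ ha hc hac
    _ ≤ ENNReal.ofReal a * ENNReal.ofReal σ + ENNReal.ofReal c * ENNReal.ofReal σ := by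
        gcongr
        · exact hu
        · exact hv
    _ = ENNReal.ofReal σ := by
        rw [← add_mul, ← ENNReal.ofReal_add ha hc, hac, ENNReal.ofReal_one, one_mul]

theorem exists_isOptSol_primal {X Y : Type*} [NormedAddCommGroup X] [InnerProductSpace ℝ X]
    [FiniteDimensional ℝ X] [NormedAddCommGroup Y] [InnerProductSpace ℝ Y] {κ : X → ℝ≥0∞}
    {ρ : Y → ℝ≥0∞} {A : X →ₗ[ℝ] Y} {b : Y} {σ α : ℝ} (hκc : LowerSemicontinuous κ)
    (hρc : LowerSemicontinuous ρ) (hα : 0 < α) {x₀ : X} (hx₀ : x₀ ∈ primalFeas ρ A b σ)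
    (hκx₀ : κ x₀ ≠ ⊤) : ∃ x, IsOptSol (primalFeas ρ A b σ) (primalObj κ α) x := by
  have hA : Continuous A := A.continuous_of_finiteDimensional
  refine LowerSemicontinuous.exists_isMinOn_of_norm_le (lowerSemicontinuous_primalObj hκc) ?_ hx₀
    (R := (primalObj κ α x₀).toReal / α) fun x _ hx => ?_
  · exact (hρc.isClosed_preimage (ENNReal.ofReal σ)).preimage
      (f := fun x => b - A x) (continuous_const.sub hA)
  · rw [le_div_iff₀' hα, ← ENNReal.ofReal_le_iff_le_toReal (primalObj_ne_top_iff.mpr hκx₀)]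
    exact le_add_self.trans hx

/-- The dual constraint expresses that `⟪·, y⟫ ≥ 1` on `C = {u | ρ (b - u) ≤ σ}`, because
`σ ρ°(y)` is the support function of `{v | ρ v ≤ σ}`. For `σ = 0` this set is the origin. -/
theorem mem_dualFeas_iff {Y : Type*} [NormedAddCommGroup Y] [InnerProductSpace ℝ Y]
    {ρ : Y → ℝ≥0∞} {b y : Y} {σ : ℝ} (hρ : IsGauge ρ) (hρ_zero : ρ ⁻¹' {0} = {0}) (hσ : 0 ≤ σ) :
    y ∈ dualFeas ρ b σ ↔ ∀ u ∈ constraintSet ρ b σ, 1 ≤ ⟪u, y⟫_ℝ := by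
  have hz : ∀ v, ρ v = 0 → v = 0 := fun v hv => by
    have : v ∈ ρ ⁻¹' {0} := hv
    rwa [hρ_zero] at this
  have hb : b ∈ constraintSet ρ b σ := by simp [constraintSet, hρ.map_zero]
  rcases hσ.eq_or_lt with rfl | hσ
  · have hset : constraintSet ρ b 0 = {b} := by
      refine Set.Subset.antisymm (fun u hu => ?_) (by simpa using hb)
      have h0 : ρ (b - u) = 0 := by simpa [constraintSet] using hu
      exact (sub_eq_zero.mp (hz _ h0)).symm
    rw [hset]
    simp only [dualFeas, Set.mem_ofPred_eq, EReal.coe_zero, zero_mul, sub_zero,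
      Set.mem_singleton_iff, forall_eq]
    exact_mod_cast Iff.rfl
  have hfin : polarGauge ρ y ≠ ⊤ →
      (y ∈ dualFeas ρ b σ ↔ 1 ≤ ⟪b, y⟫_ℝ - σ * (polarGauge ρ y).toReal) := fun hy => by
    have hcoe : (polarGauge ρ y : EReal) = ((polarGauge ρ y).toReal : EReal) :=
      (EReal.coe_ennreal_toReal hy).symm
    rw [dualFeas, Set.mem_ofPred_eq, hcoe]
    exact_mod_cast Iff.rfl
  constructor
  · intro hy u hu
    by_cases hyt : polarGauge ρ y = ⊤
    · rw [dualFeas, Set.mem_ofPred_eq, hyt, EReal.coe_ennreal_top, EReal.coe_mul_top_of_pos hσ,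
        EReal.sub_top] at hy
      exact absurd (le_bot_iff.mp hy) (EReal.coe_ne_bot 1)
    have h1 := (hfin hyt).mp hy
    have hut : ρ (b - u) ≠ ⊤ := ne_top_of_le_ne_top ENNReal.ofReal_ne_top hu
    have h2 := inner_le_polarGauge_mul hyt hut
    have h3 : (ρ (b - u)).toReal ≤ σ := ENNReal.toReal_le_of_le_ofReal hσ.le hu
    have h4 := mul_le_mul_of_nonneg_left h3 (ENNReal.toReal_nonneg (a := polarGauge ρ y))
    rw [inner_sub_left] at h2
    linarith
  · intro h
    have hm : 0 ≤ (⟪b, y⟫_ℝ - 1) / σ := div_nonneg (by linarith [h b hb]) hσ.le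
    have hle : polarGauge ρ y ≤ ENNReal.ofReal ((⟪b, y⟫_ℝ - 1) / σ) := by
      refine (polarGauge_le_ofReal_iff hm).mpr fun v hv => ?_
      rcases eq_or_ne (ρ v) 0 with h0 | h0
      · simp [hz v h0, hρ.map_zero]
      have hv0 : 0 < (ρ v).toReal := ENNReal.toReal_pos h0 hv
      -- rescale `v` to the boundary of `{v | ρ v ≤ σ}`
      have hs : 0 < σ / (ρ v).toReal := by positivity
      have hmem : b - (σ / (ρ v).toReal) • v ∈ constraintSet ρ b σ := by
        rw [constraintSet, Set.mem_ofPred_eq, sub_sub_cancel, hρ.map_smul _ _ hs]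
        refine (ENNReal.le_ofReal_iff_toReal_le
          (ENNReal.mul_ne_top ENNReal.ofReal_ne_top hv) hσ.le).mpr ?_
        rw [ENNReal.toReal_mul, ENNReal.toReal_ofReal hs.le, div_mul_cancel₀ _ hv0.ne']
      have h1 := h _ hmem
      rw [inner_sub_left, real_inner_smul_left] at h1
      have h2 : σ / (ρ v).toReal * ⟪v, y⟫_ℝ ≤ ⟪b, y⟫_ℝ - 1 := by linarith
      rw [div_mul_eq_mul_div, div_le_iff₀ hv0] at h2
      rw [div_mul_eq_mul_div, le_div_iff₀ hσ]
      linarith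
    have hyt := ne_top_of_le_ne_top ENNReal.ofReal_ne_top hle
    rw [hfin hyt]
    have h1 := ENNReal.toReal_le_of_le_ofReal hm hle
    rw [le_div_iff₀ hσ] at h1
    linarith

/-! ### Strong duality -/

open scoped Pointwise in
/-- The dual multiplier: a vector `y` with `⟪·, y⟫ ≥ 1` on `C` and `⟪A x, y⟫ ≤ φ(x) / v`, where
`φ = κ + α‖·‖` and `v` is a positive lower bound of `φ` on the primal feasible set. It comes from
properly separating `A {φ < v}` and `C`. If the separating functional were nonpositive on
`A {φ < v}`, it would vanish at `A x₀`, which is a relative interior point of both sets. -/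
theorem exists_dual_multiplier {X Y : Type*} [NormedAddCommGroup X] [InnerProductSpace ℝ X]
    [NormedAddCommGroup Y] [InnerProductSpace ℝ Y] [FiniteDimensional ℝ Y]
    {κ : X → ℝ≥0∞} {ρ : Y → ℝ≥0∞} {A : X →ₗ[ℝ] Y} {b : Y} {σ α v : ℝ}
    (hκ : IsGauge κ) (hρ : IsGauge ρ) (hα : 0 < α) {x₀ : X}
    (hx₀ : x₀ ∈ intrinsicInterior ℝ (effDom κ))
    (hAx₀ : A x₀ ∈ intrinsicInterior ℝ (constraintSet ρ b σ)) (hv : 0 < v)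
    (hmin : ∀ x ∈ primalFeas ρ A b σ, ENNReal.ofReal v ≤ primalObj κ α x) :
    ∃ y : Y, (∀ u ∈ constraintSet ρ b σ, 1 ≤ ⟪u, y⟫_ℝ) ∧
      ∀ x, κ x ≠ ⊤ → ⟪A x, y⟫_ℝ ≤ v⁻¹ * (primalObj κ α x).toReal := by
  have hφ : IsGauge (primalObj κ α) := isGauge_primalObj hκ hα
  set C := constraintSet ρ b σ with hC
  set D : Set X := {x | primalObj κ α x ≠ ⊤ ∧ (primalObj κ α x).toReal < v} with hD
  have hAx₀C : A x₀ ∈ C := intrinsicInterior_subset hAx₀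
  have hDconv : Convex ℝ D := fun x hx w hw a c ha hc hac =>
    ⟨hφ.combo_ne_top ha hc hac hx.1 hw.1, (hφ.toReal_combo_le ha hc hac hx.1 hw.1).trans_lt
      (convex_Iio v hx.2 hw.2 ha hc hac)⟩
  have h0D : (0 : X) ∈ D := by simp [hD, hφ.map_zero, hv]
  have hMconv : Convex ℝ (A '' D - C) := (hDconv.linear_image A).sub (convex_constraintSet hρ b σ)
  have hMne : (A '' D - C).Nonempty := ⟨_, Set.sub_mem_sub (Set.mem_image_of_mem A h0D) hAx₀C⟩
  have h0M : (0 : Y) ∉ A '' D - C := by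
    rintro ⟨_, ⟨x, hx, rfl⟩, u, hu, hxu⟩
    have hxu' : A x = u := sub_eq_zero.mp hxu
    have hfeas : x ∈ primalFeas ρ A b σ := by rw [← hxu'] at hu; exact hu
    have := (ENNReal.ofReal_le_iff_le_toReal hx.1).mp (hmin x hfeas)
    exact absurd hx.2 (not_lt.mpr this)
  obtain ⟨y, hle, m, ⟨_, ⟨x₁, hx₁, rfl⟩, u₁, hu₁, rfl⟩, hne⟩ :=
    hMconv.exists_inner_nonpos_of_zero_notMem hMne h0M
  have hsep : ∀ x ∈ D, ∀ u ∈ C, ⟪A x, y⟫_ℝ ≤ ⟪u, y⟫_ℝ := fun x hx u hu => by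
    have := hle _ (Set.sub_mem_sub (Set.mem_image_of_mem A hx) hu)
    rwa [inner_sub_left, sub_nonpos] at this
  -- every point of the domain can be scaled into `D`
  have hscale : ∀ x, κ x ≠ ⊤ → ∀ s, (primalObj κ α x).toReal < s → (v / s) • x ∈ D := by
    intro x hx s hs
    have hs0 : 0 < s := ENNReal.toReal_nonneg.trans_lt hs
    refine ⟨hφ.smul_ne_top (by positivity) (primalObj_ne_top_iff.mpr hx), ?_⟩
    rw [hφ.toReal_smul (by positivity), div_mul_eq_mul_div, div_lt_iff₀ hs0]
    exact mul_lt_mul_of_pos_left hs hv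
  obtain ⟨x₂, hx₂, hx₂pos⟩ : ∃ x ∈ D, 0 < ⟪A x, y⟫_ℝ := by
    by_contra! hcon
    have hCnonneg : ∀ u ∈ C, 0 ≤ ⟪u, y⟫_ℝ := fun u hu => by
      simpa using hsep 0 h0D u hu
    have hdom : ∀ x ∈ effDom κ, ⟪A x, y⟫_ℝ ≤ 0 := fun x hx => by
      have hs0 := ENNReal.toReal_nonneg.trans_lt (lt_add_one (primalObj κ α x).toReal)
      have := hcon _ (hscale x (ne_of_lt hx) _ (lt_add_one _))
      rw [map_smul, real_inner_smul_left] at this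
      exact nonpos_of_mul_nonpos_right this (by positivity)
    have hx₀zero : ⟪A x₀, y⟫_ℝ = 0 :=
      (hdom x₀ (intrinsicInterior_subset hx₀)).antisymm (hCnonneg _ hAx₀C)
    have hdom0 : ⟪A x₁, y⟫_ℝ = 0 := by
      have := LinearMap.eq_zero_of_mem_intrinsicInterior (-(innerₗ Y y ∘ₗ A)) hx₀
        (fun x hx => by simpa [real_inner_comm] using hdom x hx)
        (by simpa [real_inner_comm] using hx₀zero)
        (show x₁ ∈ effDom κ from lt_top_iff_ne_top.mpr (primalObj_ne_top_iff.mp hx₁.1))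
      simpa [real_inner_comm] using this
    have hC0 : ⟪u₁, y⟫_ℝ = 0 := by
      have := LinearMap.eq_zero_of_mem_intrinsicInterior (innerₗ Y y) hAx₀
        (fun u hu => by simpa [real_inner_comm] using hCnonneg u hu)
        (by simpa [real_inner_comm] using hx₀zero) hu₁
      simpa [real_inner_comm] using this
    exact hne (by simp [inner_sub_left, hdom0, hC0])
  have hbdd : BddBelow ((fun u => ⟪u, y⟫_ℝ) '' C) :=
    ⟨⟪A x₂, y⟫_ℝ, by rintro _ ⟨u, hu, rfl⟩; exact hsep x₂ hx₂ u hu⟩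
  have hCne : ((fun u => ⟪u, y⟫_ℝ) '' C).Nonempty := ⟨_, _, hAx₀C, rfl⟩
  set c : ℝ := sInf ((fun u => ⟪u, y⟫_ℝ) '' C) with hc
  have hDc : ∀ x ∈ D, ⟪A x, y⟫_ℝ ≤ c := fun x hx =>
    le_csInf hCne (by rintro _ ⟨u, hu, rfl⟩; exact hsep x hx u hu)
  have hc0 : 0 < c := hx₂pos.trans_le (hDc x₂ hx₂)
  refine ⟨c⁻¹ • y, fun u hu => ?_, fun x hx => ?_⟩
  · rw [real_inner_smul_right, le_inv_mul_iff₀ hc0, mul_one]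
    exact csInf_le hbdd ⟨u, hu, rfl⟩
  · rw [real_inner_smul_right, inv_mul_le_iff₀ hc0]
    refine le_of_forall_pos_le_add fun ε hε => ?_
    have hs : (primalObj κ α x).toReal < (primalObj κ α x).toReal + ε * v / c := by
      have : 0 < ε * v / c := by positivity
      linarith
    have hs0 := ENNReal.toReal_nonneg.trans_lt hs
    have h1 := hDc _ (hscale x hx _ hs)
    rw [map_smul, real_inner_smul_left, div_mul_eq_mul_div, div_le_iff₀ hs0] at h1
    have h2 : c * (v⁻¹ * (primalObj κ α x).toReal) + ε =
        (c * ((primalObj κ α x).toReal + ε * v / c)) / v := by field_simp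
    rw [h2, le_div_iff₀ hv]
    linarith

/-! ### Smoothness of the dual objective and recovery of a primal solution -/

theorem dualObj_eq {X Y : Type*} [NormedAddCommGroup X] [InnerProductSpace ℝ X]
    [FiniteDimensional ℝ X] [NormedAddCommGroup Y] [InnerProductSpace ℝ Y] [FiniteDimensional ℝ Y]
    {κ : X → ℝ≥0∞} {α : ℝ} (hκ : IsGauge κ) (hκc : LowerSemicontinuous κ) (hα : 0 < α)
    (A : X →ₗ[ℝ] Y) (y : Y) :
    dualObj κ α A y = polarGauge (primalObj κ α) (LinearMap.adjoint A y) := by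
  rw [dualObj, polarEnvelope_polarGauge hκ hκc hα]

/-- The dual objective is smooth on the half-space `⟪A x₀, ·⟫ > 0`, for any `x₀` in the domain
of `κ`: it is positive there. -/
theorem hasLocallyLipschitzGradientOn_dualObj {X Y : Type*} [NormedAddCommGroup X]
    [InnerProductSpace ℝ X] [FiniteDimensional ℝ X] [NormedAddCommGroup Y] [InnerProductSpace ℝ Y]
    [FiniteDimensional ℝ Y] {κ : X → ℝ≥0∞} {α : ℝ} (hκ : IsGauge κ)
    (hκc : LowerSemicontinuous κ) (hα : 0 < α) (A : X →ₗ[ℝ] Y) {x₀ : X} (hx₀ : κ x₀ ≠ ⊤)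
    {S : Set Y} (hS : ∀ y ∈ S, 0 < ⟪A x₀, y⟫_ℝ) :
    HasLocallyLipschitzGradientOn (dualObj κ α A) S := by
  obtain ⟨g, hg, hgLip⟩ := exists_locallyLipschitzOn_subgradient hκ hκc hα
  set U : Set Y := {y | 0 < ⟪A x₀, y⟫_ℝ} with hU
  have hUo : IsOpen U := isOpen_lt continuous_const (by fun_prop)
  have hmaps : Set.MapsTo (LinearMap.adjoint A) U
      {z | 0 < (polarGauge (primalObj κ α) z).toReal} := fun y (hy : 0 < ⟪A x₀, y⟫_ℝ) => by
    have h := inner_le_polarGauge_mul (polarGauge_primalObj_ne_top (κ := κ) hα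
      (LinearMap.adjoint A y)) (primalObj_ne_top_iff.mpr hx₀)
    rw [LinearMap.adjoint_inner_right] at h
    exact pos_of_mul_pos_left (hy.trans_le h) ENNReal.toReal_nonneg
  have hGLip : LocallyLipschitzOn U fun y => A (g (LinearMap.adjoint A y)) := by
    have h := hgLip.comp_lipschitzWith
      (LinearMap.toContinuousLinearMap (LinearMap.adjoint A)).lipschitz hmaps
    exact h.contDiffAt_comp (Φ := LinearMap.toContinuousLinearMap A)
      fun y _ => (LinearMap.toContinuousLinearMap A).contDiff.contDiffAt
  refine ⟨U, hUo, hS, fun y _ => ?_, fun y => A (g (LinearMap.adjoint A y)), fun y hy => ?_, hGLip⟩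
  · rw [dualObj_eq hκ hκc hα]
    exact polarGauge_primalObj_ne_top hα _
  · refine hasFDerivAt_of_continuousOn_subgradient hUo hGLip.continuousOn (fun y hy w _ => ?_) hy
    obtain ⟨h1, h2⟩ := hg _ (hmaps hy)
    rw [dualObj_eq hκ hκc hα, dualObj_eq hκ hκc hα, ← LinearMap.adjoint_inner_right, map_sub,
      inner_sub_right, h1]
    linarith [h2 (LinearMap.adjoint A w)]

/-- Primal recovery. If `⟪x, z⟫ ≥ 1` and `r φ(x) = 1` with `r = φ°(z)`, where `φ = κ + α‖·‖`, then
equality in the Cauchy–Schwarz inequality makes `x` a positive multiple of `p = prox_{rκ}(z)`, and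
the multiple is determined by `φ(x) = 1 / r`. -/
theorem IsProxPoint.smul_eq {X : Type*} [NormedAddCommGroup X] [InnerProductSpace ℝ X]
    {κ : X → ℝ≥0∞} {α r : ℝ} {x z p : X} (hκ : IsGauge κ) (hα : 0 < α) (hr : 0 < r)
    (hp : IsProxPoint κ r z p) (hz : (polarGauge (primalObj κ α) z).toReal = r) (hx : κ x ≠ ⊤)
    (hxz : 1 ≤ ⟪x, z⟫_ℝ) (hrx : r * (primalObj κ α x).toReal = 1) :
    ((1 / r) / ((κ p).toReal + α * ‖p‖)) • p = x := by
  have hnp : ‖p‖ = α * r := hp.norm_eq hα hr hz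
  have hnp0 : 0 < ‖p‖ := by rw [hnp]; positivity
  have hx0 : 0 < ‖x‖ := by
    rw [norm_pos_iff]
    rintro rfl
    rw [inner_zero_left] at hxz
    linarith
  have hcs : ⟪x, p⟫_ℝ = ‖x‖ * ‖p‖ := by
    refine (real_inner_le_norm x p).antisymm ?_
    have h1 := hp.inner_le x hx
    rw [inner_sub_right] at h1
    rw [toReal_primalObj hα hx] at hrx
    rw [hnp]
    linarith
  have hxp : x = (‖x‖ / ‖p‖) • p := by
    have h := inner_eq_norm_mul_iff_real.mp hcs
    rw [div_eq_inv_mul, mul_smul, ← h, inv_smul_smul₀ hnp0.ne']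
  have hc : 0 < ‖x‖ / ‖p‖ := by positivity
  have hφ : (primalObj κ α x).toReal = ‖x‖ / ‖p‖ * (primalObj κ α p).toReal := by
    conv_lhs => rw [hxp]
    exact (isGauge_primalObj hκ hα).toReal_smul hc p
  rw [toReal_primalObj hα hp.ne_top] at hφ
  have hκp : 0 < (κ p).toReal + α * ‖p‖ :=
    add_pos_of_nonneg_of_pos ENNReal.toReal_nonneg (by positivity)
  conv_rhs => rw [hxp]
  congr 1
  rw [hφ] at hrx
  rw [div_eq_iff hκp.ne', div_eq_iff hr.ne']
  linarith

theorem mainTheorem3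
    {X Y : Type*} [NormedAddCommGroup X] [InnerProductSpace ℝ X] [FiniteDimensional ℝ X]
    [NormedAddCommGroup Y] [InnerProductSpace ℝ Y] [FiniteDimensional ℝ Y]
    (κ : X → ℝ≥0∞) (ρ : Y → ℝ≥0∞) (A : X →ₗ[ℝ] Y) (b : Y) (σ α : ℝ)
    (hκ : IsGauge κ) (hκ_closed : LowerSemicontinuous κ) (hκ_zero : κ ⁻¹' {0} = {0})
    (hρ : IsGauge ρ) (hρ_closed : LowerSemicontinuous ρ) (hρ_zero : ρ ⁻¹' {0} = {0})
    (hσ : 0 ≤ σ) (hσb : ENNReal.ofReal σ < ρ b) (hα : 0 < α)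
    (hCQ : (intrinsicInterior ℝ (effDom κ) ∩
      A ⁻¹' intrinsicInterior ℝ (constraintSet ρ b σ)).Nonempty) :
    -- (i) the optimal values are finite, positive, attained, and reciprocal to each other
    ((0 < optValue (primalFeas ρ A b σ) (primalObj κ α) ∧
        optValue (primalFeas ρ A b σ) (primalObj κ α) < ⊤ ∧
        ∃ x, IsOptSol (primalFeas ρ A b σ) (primalObj κ α) x) ∧
      (0 < optValue (dualFeas ρ b σ) (dualObj κ α A) ∧
        optValue (dualFeas ρ b σ) (dualObj κ α A) < ⊤ ∧
        ∃ y, IsOptSol (dualFeas ρ b σ) (dualObj κ α A) y) ∧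
      optValue (primalFeas ρ A b σ) (primalObj κ α) =
        (optValue (dualFeas ρ b σ) (dualObj κ α A))⁻¹) ∧
    -- (ii) smoothness of the dual objective
    HasLocallyLipschitzGradientOn (dualObj κ α A) (dualFeas ρ b σ) ∧
    -- (iii) recovery of a primal solution; `p` is the value of the proximal map
    (∀ (y : Y) (r : ℝ), IsOptSol (dualFeas ρ b σ) (dualObj κ α A) y →
      r = (optValue (dualFeas ρ b σ) (dualObj κ α A)).toReal →
      ∃ p : X, proxSet r κ (LinearMap.adjoint A y) = {p} ∧ κ p < ⊤ ∧ p ≠ 0 ∧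
        IsOptSol (primalFeas ρ A b σ) (primalObj κ α)
          (((1 / r) / ((κ p).toReal + α * ‖p‖)) • p)) := by
  obtain ⟨x₀, hx₀, hAx₀⟩ := hCQ
  have hx₀dom : x₀ ∈ effDom κ := intrinsicInterior_subset hx₀
  have hκx₀ : κ x₀ ≠ ⊤ := ne_of_lt hx₀dom
  have hAx₀C : A x₀ ∈ constraintSet ρ b σ := intrinsicInterior_subset hAx₀
  have hx₀feas : x₀ ∈ primalFeas ρ A b σ := hAx₀C
  have hobj := dualObj_eq hκ hκ_closed hα A
  have hdual : ∀ y ∈ dualFeas ρ b σ, ∀ x ∈ primalFeas ρ A b σ, 1 ≤ ⟪A x, y⟫_ℝ :=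
    fun y hy x hx => (mem_dualFeas_iff hρ hρ_zero hσ).mp hy (A x) hx
  obtain ⟨xs, hxs⟩ := exists_isOptSol_primal hκ_closed hρ_closed hα hx₀feas hκx₀
  have hxs_top : primalObj κ α xs ≠ ⊤ :=
    ne_top_of_le_ne_top (primalObj_ne_top_iff.mpr hκx₀) (hxs.2 hx₀feas)
  have hκxs : κ xs ≠ ⊤ := primalObj_ne_top_iff.mp hxs_top
  have hxs0 : xs ≠ 0 := by
    rintro rfl
    have h := hxs.1
    rw [primalFeas, Set.mem_ofPred_eq, map_zero, sub_zero] at h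
    exact absurd h (not_le.mpr hσb)
  set v : ℝ := (primalObj κ α xs).toReal with hv
  have hv0 : 0 < v := by
    rw [hv, toReal_primalObj hα hκxs]
    exact add_pos_of_nonneg_of_pos ENNReal.toReal_nonneg (mul_pos hα (norm_pos_iff.mpr hxs0))
  have hobj_xs : primalObj κ α xs = ENNReal.ofReal v := (ENNReal.ofReal_toReal hxs_top).symm
  have hP : optValue (primalFeas ρ A b σ) (primalObj κ α) = ENNReal.ofReal v := by
    rw [hxs.optValue_eq, hobj_xs]
  have hweak : ∀ y ∈ dualFeas ρ b σ, ENNReal.ofReal v⁻¹ ≤ dualObj κ α A y := fun y hy => by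
    have htop := polarGauge_primalObj_ne_top (κ := κ) hα (LinearMap.adjoint A y)
    have h := inner_le_polarGauge_mul htop hxs_top
    rw [LinearMap.adjoint_inner_right] at h
    rw [hobj, ENNReal.ofReal_le_iff_le_toReal htop, inv_le_iff_one_le_mul₀ hv0]
    exact (hdual y hy xs hxs.1).trans h
  obtain ⟨ys, hys, hysA⟩ := exists_dual_multiplier hκ hρ hα hx₀ hAx₀ hv0
    (fun x hx => by rw [← hobj_xs]; exact hxs.2 hx)
  have hys_feas : ys ∈ dualFeas ρ b σ := (mem_dualFeas_iff hρ hρ_zero hσ).mpr hys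
  have hys_le : dualObj κ α A ys ≤ ENNReal.ofReal v⁻¹ := by
    rw [hobj]
    refine (polarGauge_le_ofReal_iff (by positivity)).mpr fun x hx => ?_
    rw [LinearMap.adjoint_inner_right]
    exact hysA x (primalObj_ne_top_iff.mp hx)
  have hys_opt : IsOptSol (dualFeas ρ b σ) (dualObj κ α A) ys :=
    ⟨hys_feas, fun y hy => hys_le.trans (hweak y hy)⟩
  have hD : optValue (dualFeas ρ b σ) (dualObj κ α A) = ENNReal.ofReal v⁻¹ := by
    rw [hys_opt.optValue_eq]
    exact hys_le.antisymm (hweak ys hys_feas)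
  refine ⟨⟨⟨?_, ?_, xs, hxs⟩, ⟨?_, ?_, ys, hys_opt⟩, ?_⟩, ?_, ?_⟩
  · rw [hP]; exact ENNReal.ofReal_pos.mpr hv0
  · rw [hP]; exact ENNReal.ofReal_lt_top
  · rw [hD]; exact ENNReal.ofReal_pos.mpr (inv_pos.mpr hv0)
  · rw [hD]; exact ENNReal.ofReal_lt_top
  · rw [hP, hD, ENNReal.ofReal_inv_of_pos hv0, inv_inv]
  · exact hasLocallyLipschitzGradientOn_dualObj hκ hκ_closed hα A hκx₀
      fun y hy => one_pos.trans_le (hdual y hy x₀ hx₀feas)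
  · intro y r hy hr
    have hrv : r = v⁻¹ := by rw [hr, hD, ENNReal.toReal_ofReal (by positivity)]
    have hr0 : 0 < r := by rw [hrv]; positivity
    have hz : (polarGauge (primalObj κ α) (LinearMap.adjoint A y)).toReal = r := by
      rw [← hobj, ← hy.optValue_eq, hr]
    obtain ⟨p, hpset, hp⟩ := exists_proxSet_eq_singleton hκ hκ_closed hr0 (LinearMap.adjoint A y)
    refine ⟨p, hpset, lt_top_iff_ne_top.mpr hp.ne_top, ?_, ?_⟩
    · rw [← norm_pos_iff, hp.norm_eq hα hr0 hz]
      positivity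
    · rw [hp.smul_eq hκ hα hr0 hz hκxs
        (by rw [LinearMap.adjoint_inner_right]; exact hdual y hy.1 xs hxs.1)
        (by rw [hrv, ← hv, inv_mul_cancel₀ hv0.ne'])]
      exact hxs
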